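/- **Setting.** Let $\mathcal G^0,\dots,\mathcal G^T$ be finite simple undirected graphs whose nodes carry labels from a finite label set. The node set $\mathcal V^t$ consists of the labels that carry at least one edge of $\mathcal G^t$; $n_t=|\mathcal V^t|$, $d^t(u)$ is the degree of $u$ and $\bar d^t=\frac1{n_t}\sum_{u\in\mathcal V^t}d^t(u)$. Nodes may appear and disappear, but the label of a node that has disappeared is not reused. For $1\le t\le T$ let $\Delta\mathcal G^t$ be a finite sequence of edge events (insertion of a missing edge or deletion of a present edge) that turns $\mathcal G^{t-1}$ into $\mathcal G^t$. Let $m_t$ be a natural number such that $\mathcal G^t$ has at most $m_t$ edges and $\Delta\mathcal G^t$ has at most $m_t$ events (for instance $m_t=|\mathcal E^t|$ whenever the batch has at most $|\mathcal E^t|$ events). Let $0<\alpha\le 1$ be the teleport probability, $0<\varepsilon\le 2$, and $\varepsilon^t=\varepsilon/m_t$. **Algorithm.** A source $s$ has an estimate $p_s$ and a residual $r_s$ (real vectors on the labels), initially $p_s=0$, $r_s=\mathbf 1_s$. $\mathrm{ForwardPush}(p_s,r_s,\mathcal G,\eta)$: while some node $u$ of $\mathcal G$ has $r_s(u)>\eta\,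 d(u)$, push such a $u$; then, while some node $u$ has $r_s(u)<-\eta\, d(u)$, push such a $u$. To push $u$ means: with $\rho=r_s(u)$, add $\alpha\rho$ to $p_s(u)$, add $(1-\alpha)\rho/d(u)$ to $r_s(v)$ for each neighbour $v$ of $u$, and set $r_s(u)=0$. $\mathrm{DynamicSNE}(\mathcal G^t,\Delta\mathcal G^t,s,p_s^{t-1},r_s^{t-1},\varepsilon^t,\alpha)$: (1) for each event on $\{u,v\}$, in order, and for both of its orientations $(u,v)$, put $\delta=p_s(u)/(d(u)-1)$ for an insertion and $\delta=-p_s(u)/(d(u)+1)$ for a deletion, where $d(u)$ is the degree right after the event ($\delta=0$ if an insertion gives $u$ its first edge); add $\delta$ to $p_s(u)$, subtract $\delta/\alpha$ from $r_s(u)$, and add $\delta/\alpha-\delta$ to $r_s(v)$; (2) run $\mathrm{ForwardPush}$ on $\mathcal G^t$ with precision $\varepsilon^t$, giving $p_s^t,r_s^t$; (3) for each node $i$ of $\mathcal G^t$ with $p_s^t(i)\ne0$, add $h_{\mathrm{sgn}}(i)\max(\log(p_s^t(i)n_t),0)$ (nothing if $p_s^t(i)<0$) to coordinate $h_d(i)$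 of the embedding $w_s^t$, which starts at $0$, where $h_d$ and $h_{\mathrm{sgn}}$ are hash functions into the $d$ coordinates and into $\{\pm1\}$. The states $(p_s^t,r_s^t)$ arise by calling this procedure on $\mathcal G^0$ with the empty batch and an arbitrary precision $\varepsilon_0>0$, and then once for each $t=1,\dots,T$. The running time counts one unit for each orientation of an event, $d^t(u)+1$ units for a push of $u$, one unit for each node in loop (3), and one unit each for switching between the two while-loops and for initializing the embedding. **Theorem.** There is an absolute constant $C>0$ such that in this setting, for all choices of the pushed nodes and every $1\le t\le T$: for every source $s$ the call of $\mathrm{DynamicSNE}$ for $\Delta\mathcal G^t$ terminates, and its running time $T_s^t$, averaged over the source nodes $s$ of $\mathcal G^t$, satisfies $$\frac1{n_t}\sum_{s\in\mathcal V^t}T_s^t\;\le\; C\left(\frac{m_t}{\alpha^2}+\frac{m_t\,\bar d^t}{\varepsilon\,\alpha^2}+\frac{m_t}{\varepsilon\,\alpha}\right).$$ (For $\mathcal V^t=\emptyset$ the average and $\bar d^t$ are read as $0$.) -/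

import Mathlib

/-! Dynamic graphs on the label set `Fin N`.  The nodes of a snapshot are the labels that carry at
least one edge; labels without an edge are not (or not yet, or no longer) part of the graph. -/

/-- Degree of a node. -/
noncomputable def deg {N : ℕ} (G : SimpleGraph (Fin N)) (u : Fin N) : ℕ :=
  (G.neighborSet u).ncard

open Classical in
/-- The node set `𝒱` of a snapshot. -/
noncomputable def nodes {N : ℕ} (G : SimpleGraph (Fin N)) : Finset (Fin N) :=
  Finset.univ.filter (fun u => 0 < deg G u)

/-- The average degree `d̄` of a snapshot. -/
noncomputable def avgDegree {N : ℕ} (G : SimpleGraph (Fin N)) : ℝ :=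
  (∑ u ∈ nodes G, (deg G u : ℝ)) / ((nodes G).card : ℝ)

/-- The two types of edge events. -/
inductive EdgeOp where
  | insert
  | delete

/-- An edge event `(u, v, op)` on an undirected graph. -/
structure EdgeEvent (N : ℕ) where
  u : Fin N
  v : Fin N
  op : EdgeOp

/-- The graph after one edge event. -/
def applyEvent {N : ℕ} (G : SimpleGraph (Fin N)) (e : EdgeEvent N) : SimpleGraph (Fin N) :=
  match e.op with
  | EdgeOp.insert => G ⊔ SimpleGraph.edge e.u e.v
  | EdgeOp.delete => G.deleteEdges {s(e.u, e.v)}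

/-- Only a missing edge can be inserted and only a present edge can be deleted. -/
def ValidEvent {N : ℕ} (G : SimpleGraph (Fin N)) (e : EdgeEvent N) : Prop :=
  match e.op with
  | EdgeOp.insert => e.u ≠ e.v ∧ ¬ G.Adj e.u e.v
  | EdgeOp.delete => G.Adj e.u e.v

/-- The batch is a sequence of edge events that turns `G` into `H`. -/
def IsBatch {N : ℕ} (G : SimpleGraph (Fin N)) :
    List (EdgeEvent N) → SimpleGraph (Fin N) → Prop
  | [], H => G = H
  | e :: es, H => ValidEvent G e ∧ IsBatch (applyEvent G e) es H

/-- The estimate `p` and the residual `r` that are maintained for one source. -/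
@[ext]
structure PushState (N : ℕ) where
  p : Fin N → ℝ
  r : Fin N → ℝ

/-- The initial state `p = 0`, `r = 1_s`. -/
noncomputable def initState {N : ℕ} (s : Fin N) : PushState N :=
  ⟨fun _ => 0, fun x => if x = s then 1 else 0⟩

/-- The correction of `p` and `r` for the arc `(u, v)`; `G` is the graph right after the event.
(If the arc is the first one at `u`, then `p u = 0` and the correction is `0`.) -/
noncomputable def adjustArc {N : ℕ} (G : SimpleGraph (Fin N)) (α : ℝ) (op : EdgeOp)
    (u v : Fin N) (x : PushState N) : PushState N :=
  let δ : ℝ := match op with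
    | EdgeOp.insert => x.p u / ((deg G u : ℝ) - 1)
    | EdgeOp.delete => -(x.p u / ((deg G u : ℝ) + 1))
  ⟨fun y => if y = u then x.p y + δ else x.p y,
   fun y => if y = u then x.r y - δ / α else if y = v then x.r y + δ / α - δ else x.r y⟩

/-- The loop over the update batch.  An undirected edge is a pair of opposite arcs, so each event
is processed for both orientations. -/
noncomputable def processBatch {N : ℕ} (α : ℝ) :
    SimpleGraph (Fin N) → List (EdgeEvent N) → PushState N → PushState N
  | _, [], x => x
  | G, e :: es, x =>
      processBatch α (applyEvent G e) es
        (adjustArc (applyEvent G e) α e.op e.v e.u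
          (adjustArc (applyEvent G e) α e.op e.u e.v x))

open Classical in
/-- The procedure `Push(u)`. -/
noncomputable def push {N : ℕ} (G : SimpleGraph (Fin N)) (α : ℝ) (x : PushState N)
    (u : Fin N) : PushState N :=
  ⟨fun y => if y = u then x.p y + α * x.r u else x.p y,
   fun y => if y = u then 0
     else if G.Adj u y then x.r y + (1 - α) * x.r u / (deg G u : ℝ) else x.r y⟩

/-- The two while-loops of the forward push. -/
inductive Phase where
  | positive
  | negative

/-- One step of the forward push on `G` with precision `η`, together with its cost.  The node that
is pushed may be any node that meets the condition of the current loop.  A push of `u` costs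
`deg u + 1`: one operation for each neighbour, and one for `u` itself. -/
inductive PushStep {N : ℕ} (G : SimpleGraph (Fin N)) (α η : ℝ) :
    Phase × PushState N → ℕ → Phase × PushState N → Prop
  | positive (x : PushState N) (u : Fin N) (hu : u ∈ nodes G) (hr : η * (deg G u : ℝ) < x.r u) :
      PushStep G α η (Phase.positive, x) (deg G u + 1) (Phase.positive, push G α x u)
  | switch (x : PushState N) (h : ∀ u ∈ nodes G, x.r u ≤ η * (deg G u : ℝ)) :
      PushStep G α η (Phase.positive, x) 1 (Phase.negative, x)
  | negative (x : PushState N) (u : Fin N) (hu : u ∈ nodes G)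
      (hr : x.r u < -(η * (deg G u : ℝ))) :
      PushStep G α η (Phase.negative, x) (deg G u + 1) (Phase.negative, push G α x u)

/-- Finite sequences of steps, with their total cost. -/
inductive PushSteps {N : ℕ} (G : SimpleGraph (Fin N)) (α η : ℝ) :
    Phase × PushState N → ℕ → Phase × PushState N → Prop
  | refl (a : Phase × PushState N) : PushSteps G α η a 0 a
  | tail {a b c : Phase × PushState N} {k l : ℕ} (h : PushSteps G α η a k b)
      (h' : PushStep G α η b l c) : PushSteps G α η a (k + l) c

/-- A complete execution of the forward push from `x` ends in `y` at cost `k`. -/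
def ForwardPush {N : ℕ} (G : SimpleGraph (Fin N)) (α η : ℝ) (x : PushState N) (k : ℕ)
    (y : PushState N) : Prop :=
  PushSteps G α η (Phase.positive, x) k (Phase.negative, y) ∧
    ∀ u ∈ nodes G, -(η * (deg G u : ℝ)) ≤ y.r u

/-- No execution of the forward push from `x` goes on forever. -/
def PushTerminates {N : ℕ} (G : SimpleGraph (Fin N)) (α η : ℝ) (x : PushState N) : Prop :=
  ¬ ∃ f : ℕ → Phase × PushState N,
    f 0 = (Phase.positive, x) ∧ ∀ i, ∃ k, PushStep G α η (f i) k (f (i + 1))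

open Classical in
/-- The nodes over which the projection loop runs. -/
noncomputable def supportNodes {N : ℕ} (G : SimpleGraph (Fin N)) (p : Fin N → ℝ) :
    Finset (Fin N) :=
  (nodes G).filter (fun i => p i ≠ 0)

open Classical in
/-- The hash kernel projection of the estimate into dimension `d`.  (Estimates that are negative
contribute nothing.) -/
noncomputable def hashProjection {N d : ℕ} (hd : ℕ → Fin d) (hsgn : ℕ → ℤˣ)
    (G : SimpleGraph (Fin N)) (p : Fin N → ℝ) : Fin d → ℝ :=
  fun j => ∑ i ∈ (supportNodes G p).filter (fun i => hd i.val = j),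
    ((hsgn i.val : ℤ) : ℝ) *
      (if 0 < p i then max (Real.log (p i * ((nodes G).card : ℝ))) 0 else 0)

/-- An execution of `DynamicSNE` with teleport probability `α` and precision `η`, for the batch `B`
that turns the old graph `G` into the current graph `H`: from the input `x` it returns the state
`y` and the embedding `w`, in time `c`.  The time consists of one operation for each arc of an
event, the cost of the forward push, one operation for each node in the projection loop, and
one operation for the (sparse) initialization of the embedding. -/
def DynamicSNE {N d : ℕ} (hd : ℕ → Fin d) (hsgn : ℕ → ℤˣ) (G H : SimpleGraph (Fin N))
    (B : List (EdgeEvent N)) (α η : ℝ) (x : PushState N)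
    (y : PushState N) (w : Fin d → ℝ) (c : ℕ) : Prop :=
  ∃ k : ℕ, ForwardPush H α η (processBatch α G B x) k y ∧
    w = hashProjection hd hsgn H y.p ∧
    c = 2 * B.length + k + 1 + (supportNodes H y.p).card

/-- A run of `DynamicPPE` for the source `s` over the snapshots `G 0, …, G T`, where the batch
`B t` turns `G t` into `G (t + 1)`: the initial call with an empty batch and precision `ε₀`, and
then one call for each batch, with precision `ε / m (t + 1)`.  After the call for snapshot `t` the
state is `x t`, the embedding is `w t`, and the call took time `c t`. -/
structure IsRun {N d : ℕ} (hd : ℕ → Fin d) (hsgn : ℕ → ℤˣ) (T : ℕ) (G : ℕ → SimpleGraph (Fin N))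
    (B : ℕ → List (EdgeEvent N)) (m : ℕ → ℕ) (α ε ε₀ : ℝ) (s : Fin N)
    (x : ℕ → PushState N) (w : ℕ → Fin d → ℝ) (c : ℕ → ℕ) : Prop where
  init : DynamicSNE hd hsgn (G 0) (G 0) [] α ε₀ (initState s) (x 0) (w 0) (c 0)
  step : ∀ t < T, DynamicSNE hd hsgn (G t) (G (t + 1)) (B t) α (ε / (m (t + 1) : ℝ))
    (x t) (x (t + 1)) (w (t + 1)) (c (t + 1))

/-!
Averaged over the sources, the call is cheap because the forward push is paid for by the
`ℓ¹`-norm of the residual at its start, and this residual is controlled by the estimate.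

* Every push of `u` removes at least `α |r u| > α η deg u` from the `ℓ¹`-norm of the residual
  (`l1_push_le`), so the loops terminate and cost at most `1 + 2 ‖r‖₁ / (α η)`
  (`ForwardPush.cost_le`).
* Pushes and edge events maintain `α r = α 1_s - p + (1 - α) p P`, where `P` is the random walk
  matrix of the current graph, together with `p = 0` off the graph (`PushInvariant`).  Hence the
  residual after an update batch depends only on the current graph and estimate, and
  `‖r‖₁ ≤ 1 + 2 ‖p‖₁ / α`, however many events the batch has.
* The corrections for an event keep the quotient `p u / deg u`, or set the estimate to zero
  (`abs_processBatch_p_le`).  It remains to bound `∑ s, |p_s u| / deg u` for the preceding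
  snapshot by a constant.
* The absolute values, summed over `s`, satisfy the equation of the invariant as an inequality
  `≤`, with a small error term since the preceding forward push left `|r u| ≤ η deg u`.  As `P`
  averages over neighbours after division by the degree (the graph is undirected), a maximum
  principle applies: at a node where the quotient is largest it is at most `1 + n η ≤ 5`
  (`le_mul_deg_of_le_inflow`, `sum_abs_p_le`).  The initial call has arbitrary precision, but its
  states are nonnegative, which makes the error term favourable.
* A source that enters with the current snapshot has never been in the graph before, so its
  estimate is still zero.

Consequently the residuals before the push have average norm `O(1 + d̄ / α)`, and the push, with
`η = ε / m`, has average cost `O(m / (ε α) + m d̄ / (ε α²))`.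
-/

/-! ### Degrees and flow -/

open Classical in
theorem deg_eq_sum {N : ℕ} (G : SimpleGraph (Fin N)) (u : Fin N) :
    (deg G u : ℝ) = ∑ z, if G.Adj u z then (1 : ℝ) else 0 := by
  have : deg G u = (Finset.univ.filter (fun z => G.Adj u z)).card := by
    rw [deg, ← Set.ncard_coe_finset]
    congr 1
    ext z
    simp
  rw [this, Finset.sum_boole]

theorem mem_nodes {N : ℕ} {G : SimpleGraph (Fin N)} {u : Fin N} :
    u ∈ nodes G ↔ 0 < deg G u := by
  simp [nodes]

theorem deg_eq_zero_of_notMem_nodes {N : ℕ} {G : SimpleGraph (Fin N)} {u : Fin N}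
    (h : u ∉ nodes G) : deg G u = 0 := by
  rw [mem_nodes] at h
  omega

theorem not_adj_of_deg_eq_zero {N : ℕ} {G : SimpleGraph (Fin N)} {u : Fin N}
    (h : deg G u = 0) (z : Fin N) : ¬ G.Adj u z := by
  have h' := (Set.ncard_eq_zero (Set.toFinite _)).1 h
  intro hz
  have : z ∈ G.neighborSet u := hz
  simp [h'] at this

theorem mem_nodes_of_adj {N : ℕ} {G : SimpleGraph (Fin N)} {u z : Fin N} (h : G.Adj u z) :
    u ∈ nodes G := by
  by_contra hu
  exact not_adj_of_deg_eq_zero (deg_eq_zero_of_notMem_nodes hu) z h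

theorem sum_nodes_deg {N : ℕ} (G : SimpleGraph (Fin N)) :
    ∑ u ∈ nodes G, (deg G u : ℝ) = ∑ u, (deg G u : ℝ) := by
  apply Finset.sum_subset (Finset.subset_univ _)
  intro u _ hu
  exact_mod_cast deg_eq_zero_of_notMem_nodes hu

theorem card_nodes_le {N : ℕ} (G : SimpleGraph (Fin N)) :
    (nodes G).card ≤ 2 * G.edgeSet.ncard := by
  classical
  have hd : ∀ u, deg G u = G.degree u := by
    intro u
    rw [deg, ← SimpleGraph.card_neighborSet_eq_degree, Set.ncard_eq_toFinset_card',
      Set.toFinset_card]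
  have he : G.edgeSet.ncard = G.edgeFinset.card := by
    rw [← SimpleGraph.coe_edgeFinset, Set.ncard_coe_finset]
  rw [he, ← G.sum_degrees_eq_twice_card_edges, Finset.card_eq_sum_ones]
  calc ∑ u ∈ nodes G, 1 ≤ ∑ u ∈ nodes G, G.degree u :=
        Finset.sum_le_sum fun u hu => by
          rw [← hd]
          exact mem_nodes.1 hu
    _ ≤ ∑ u, G.degree u := Finset.sum_le_sum_of_subset (Finset.subset_univ _)

open Classical in
/-- The mass that arrives at `v` when every label distributes its mass `p` evenly to its
neighbours; the row vector `p` times the random walk matrix. -/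
noncomputable def inflow {N : ℕ} (G : SimpleGraph (Fin N)) (p : Fin N → ℝ) (v : Fin N) : ℝ :=
  ∑ u, if G.Adj u v then p u / (deg G u : ℝ) else 0

/-- The `ℓ¹`-norm of a real vector on the labels. -/
noncomputable def l1 {N : ℕ} (f : Fin N → ℝ) : ℝ := ∑ y, |f y|

theorem l1_nonneg {N : ℕ} (f : Fin N → ℝ) : 0 ≤ l1 f :=
  Finset.sum_nonneg fun _ _ => abs_nonneg _

theorem abs_inflow_le {N : ℕ} (G : SimpleGraph (Fin N)) (p : Fin N → ℝ) (v : Fin N) :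
    |inflow G p v| ≤ inflow G (fun u => |p u|) v := by
  refine (Finset.abs_sum_le_sum_abs _ _).trans (Finset.sum_le_sum fun u _ => ?_)
  split_ifs
  · rw [abs_div, Nat.abs_cast]
  · simp

theorem sum_inflow_le {N : ℕ} (G : SimpleGraph (Fin N)) (p : Fin N → ℝ) (hp : ∀ u, 0 ≤ p u) :
    ∑ v, inflow G p v ≤ ∑ u, p u := by
  classical
  unfold inflow
  rw [Finset.sum_comm]
  refine Finset.sum_le_sum fun u _ => ?_
  have : ∑ v, (if G.Adj u v then p u / (deg G u : ℝ) else 0)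
      = (p u / (deg G u : ℝ)) * (deg G u : ℝ) := by
    rw [deg_eq_sum G u, Finset.mul_sum]
    simp
  rw [this]
  by_cases h : (deg G u : ℝ) = 0
  · simpa [h] using hp u
  · rw [div_mul_cancel₀ _ h]

theorem inflow_sum {N : ℕ} {ι : Type*} (G : SimpleGraph (Fin N)) (S : Finset ι)
    (p : ι → Fin N → ℝ) (v : Fin N) :
    ∑ s ∈ S, inflow G (p s) v = inflow G (fun u => ∑ s ∈ S, p s u) v := by
  classical
  unfold inflow
  rw [Finset.sum_comm]
  refine Finset.sum_congr rfl fun u _ => ?_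
  split_ifs
  · rw [Finset.sum_div]
  · simp

/-- A maximum principle for the personalized PageRank equation: the degree-normalized vector
`P u / deg u`, at a node where it is largest, is at most the average of its neighbouring values
damped by `1 - α`, plus `α K`. -/
theorem le_mul_deg_of_le_inflow {N : ℕ} (G : SimpleGraph (Fin N)) {α K : ℝ} (hα : 0 < α)
    (hα1 : α ≤ 1) (P : Fin N → ℝ)
    (h : ∀ v ∈ nodes G, P v ≤ α * (K * (deg G v : ℝ)) + (1 - α) * inflow G P v) :
    ∀ v ∈ nodes G, P v ≤ K * (deg G v : ℝ) := by
  classical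
  intro v hv
  obtain ⟨w, hw, hmax⟩ := (nodes G).exists_max_image (fun u => P u / (deg G u : ℝ)) ⟨v, hv⟩
  have hdw : 0 < (deg G w : ℝ) := by exact_mod_cast mem_nodes.1 hw
  have hdv : 0 < (deg G v : ℝ) := by exact_mod_cast mem_nodes.1 hv
  have hin : inflow G P w ≤ P w := by
    have : P w = ∑ u, if G.Adj u w then P w / (deg G w : ℝ) else 0 := by
      have h1 : P w = (P w / (deg G w : ℝ)) * (deg G w : ℝ) := by field_simp
      have h2 : (P w / (deg G w : ℝ)) * (deg G w : ℝ)
          = ∑ u, if G.Adj u w then P w / (deg G w : ℝ) else 0 := by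
        conv_lhs => rw [deg_eq_sum G w, Finset.mul_sum]
        rw [← deg_eq_sum]
        simp [SimpleGraph.adj_comm]
      exact h1.trans h2
    rw [this]
    unfold inflow
    refine Finset.sum_le_sum fun u _ => ?_
    split_ifs with hu
    · exact hmax u (mem_nodes_of_adj hu)
    · exact le_rfl
  have hw' := h w hw
  have h3 : (1 - α) * inflow G P w ≤ (1 - α) * P w :=
    mul_le_mul_of_nonneg_left hin (by linarith)
  have h4 : α * P w ≤ α * (K * (deg G w : ℝ)) := by linarith
  have h5 : P w / (deg G w : ℝ) ≤ K := by
    rw [div_le_iff₀ hdw]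
    exact le_of_mul_le_mul_left h4 hα
  exact (div_le_iff₀ hdv).1 ((hmax v hv).trans h5)

/-! ### The invariant of estimate and residual -/

/-- The invariant that the algorithm maintains for the source `s`: the estimate vanishes off the
graph, and the residual is the defect of the estimate in the personalized PageRank equation. -/
structure PushInvariant {N : ℕ} (G : SimpleGraph (Fin N)) (α : ℝ) (s : Fin N)
    (x : PushState N) : Prop where
  p_eq_zero : ∀ u, deg G u = 0 → x.p u = 0
  residual : ∀ v, α * x.r v = α * (initState s).r v - x.p v + (1 - α) * inflow G x.p v

theorem pushInvariant_initState {N : ℕ} (G : SimpleGraph (Fin N)) (α : ℝ) (s : Fin N) :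
    PushInvariant G α s (initState s) :=
  ⟨fun _ _ => rfl, fun v => by simp [initState, inflow]⟩

theorem PushInvariant.push {N : ℕ} {G : SimpleGraph (Fin N)} {α : ℝ} {s : Fin N}
    {x : PushState N} (h : PushInvariant G α s x) {u : Fin N} (hu : u ∈ nodes G) :
    PushInvariant G α s (push G α x u) := by
  classical
  refine ⟨fun y hy => ?_, fun v => ?_⟩
  · have : y ≠ u := by
      rintro rfl
      have := mem_nodes.1 hu
      omega
    simp [_root_.push, this, h.p_eq_zero y hy]
  · have hin : inflow G (_root_.push G α x u).p v
        = inflow G x.p v + if G.Adj u v then α * x.r u / (deg G u : ℝ) else 0 := by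
      have hsum : (if G.Adj u v then α * x.r u / (deg G u : ℝ) else 0)
          = ∑ y, if y = u then if G.Adj y v then α * x.r u / (deg G u : ℝ) else 0 else 0 := by
        simp
      unfold inflow
      rw [hsum, ← Finset.sum_add_distrib]
      refine Finset.sum_congr rfl fun y _ => ?_
      by_cases hy : y = u
      · subst hy
        by_cases hv : G.Adj y v <;> simp [_root_.push, hv, add_div]
      · simp [_root_.push, hy]
    rw [hin]
    have hv := h.residual v
    by_cases hvu : v = u
    · subst hvu
      simp only [_root_.push, if_true, SimpleGraph.irrefl, if_false]
      linarith
    · by_cases ha : G.Adj u v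
      · simp only [_root_.push, hvu, ha, if_true, if_false]
        linear_combination hv
      · simp only [_root_.push, hvu, ha, if_false]
        linarith

/-- The invariant determines the residual from the estimate, and the random walk does not increase
the `ℓ¹`-norm. -/
theorem PushInvariant.l1_residual_le {N : ℕ} {G : SimpleGraph (Fin N)} {α : ℝ} {s : Fin N}
    {x : PushState N} (hα : 0 < α) (hα1 : α ≤ 1) (h : PushInvariant G α s x) :
    l1 x.r ≤ 1 + 2 * l1 x.p / α := by
  have h1 : ∀ v, α * |x.r v| ≤ α * (initState s).r v + |x.p v|
      + (1 - α) * inflow G (fun u => |x.p u|) v := by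
    intro v
    have h0 : 0 ≤ (initState s).r v := by
      simp only [initState]
      split_ifs <;> norm_num
    calc α * |x.r v| = |α * x.r v| := by rw [abs_mul, abs_of_pos hα]
      _ = |α * (initState s).r v - x.p v + (1 - α) * inflow G x.p v| := by rw [h.residual v]
      _ ≤ |α * (initState s).r v| + |x.p v| + |(1 - α) * inflow G x.p v| :=
          (abs_add_le _ _).trans (add_le_add_left (abs_sub _ _) _)
      _ ≤ _ := by
          rw [abs_of_nonneg (mul_nonneg hα.le h0), abs_mul, abs_of_nonneg (sub_nonneg.2 hα1)]
          have := mul_le_mul_of_nonneg_left (abs_inflow_le G x.p v) (sub_nonneg.2 hα1)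
          linarith
  have h2 := Finset.sum_le_sum fun v (_ : v ∈ Finset.univ) => h1 v
  rw [Finset.sum_add_distrib, Finset.sum_add_distrib, ← Finset.mul_sum, ← Finset.mul_sum,
    ← Finset.mul_sum] at h2
  have h3 : ∑ v, (initState s).r v = 1 := by simp [initState]
  rw [h3] at h2
  have h4 := mul_le_mul_of_nonneg_left
    (sum_inflow_le G (fun u => |x.p u|) fun u => abs_nonneg _) (sub_nonneg.2 hα1)
  have h5 : α * l1 x.r ≤ α + 2 * l1 x.p := by
    have := mul_nonneg hα.le (l1_nonneg x.p)
    unfold l1 at *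
    linarith
  have h6 : 1 + 2 * l1 x.p / α = (α + 2 * l1 x.p) / α := by field_simp
  rw [h6, le_div_iff₀ hα]
  linarith

/-! ### Edge events -/

/-- `H` arises from `G` by inserting or deleting `v` in the neighbourhood of `u`: an edge event as
seen from one of its endpoints. -/
def ArcEvent {N : ℕ} (op : EdgeOp) (G H : SimpleGraph (Fin N)) (u v : Fin N) : Prop :=
  match op with
  | EdgeOp.insert => v ∉ G.neighborSet u ∧ H.neighborSet u = insert v (G.neighborSet u)
  | EdgeOp.delete => v ∉ H.neighborSet u ∧ G.neighborSet u = insert v (H.neighborSet u)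

/-- The amount by which the estimate at `u` changes when an arc event at `u` led to `H`. -/
noncomputable def arcShift {N : ℕ} (H : SimpleGraph (Fin N)) (op : EdgeOp) (p : Fin N → ℝ)
    (u : Fin N) : ℝ :=
  match op with
  | EdgeOp.insert => p u / ((deg H u : ℝ) - 1)
  | EdgeOp.delete => -(p u / ((deg H u : ℝ) + 1))

theorem ValidEvent.ne {N : ℕ} {G : SimpleGraph (Fin N)} {e : EdgeEvent N}
    (h : ValidEvent G e) : e.u ≠ e.v := by
  obtain ⟨u, v, _ | _⟩ := e
  · exact h.1
  · exact SimpleGraph.Adj.ne h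

theorem ValidEvent.arcEvent {N : ℕ} {G : SimpleGraph (Fin N)} {e : EdgeEvent N}
    (h : ValidEvent G e) : ArcEvent e.op G (applyEvent G e) e.u e.v := by
  have hne := h.ne
  obtain ⟨u, v, _ | _⟩ := e
  · refine ⟨h.2, ?_⟩
    ext z
    simp only [applyEvent, SimpleGraph.mem_neighborSet, SimpleGraph.sup_adj,
      SimpleGraph.edge_adj, Set.mem_insert_iff]
    simp only at hne
    grind
  · have h' : G.Adj u v := h
    refine ⟨by simp [applyEvent], ?_⟩
    ext z
    simp only [applyEvent, SimpleGraph.mem_neighborSet, SimpleGraph.deleteEdges_adj,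
      Set.mem_insert_iff, Set.mem_singleton_iff, Sym2.eq_iff]
    simp only at hne
    grind

theorem ValidEvent.arcEvent_symm {N : ℕ} {G : SimpleGraph (Fin N)} {e : EdgeEvent N}
    (h : ValidEvent G e) : ArcEvent e.op G (applyEvent G e) e.v e.u := by
  have hne := h.ne
  obtain ⟨u, v, _ | _⟩ := e
  · refine ⟨fun h' => h.2 h'.symm, ?_⟩
    ext z
    simp only [applyEvent, SimpleGraph.mem_neighborSet, SimpleGraph.sup_adj,
      SimpleGraph.edge_adj, Set.mem_insert_iff]
    simp only at hne
    grind
  · have h' : G.Adj v u := h.symm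
    refine ⟨by simp [applyEvent, Sym2.eq_swap], ?_⟩
    ext z
    simp only [applyEvent, SimpleGraph.mem_neighborSet, SimpleGraph.deleteEdges_adj,
      Set.mem_insert_iff, Set.mem_singleton_iff, Sym2.eq_iff]
    simp only at hne
    grind

theorem applyEvent_adj_of_ne {N : ℕ} (G : SimpleGraph (Fin N)) (e : EdgeEvent N) {y : Fin N}
    (hu : y ≠ e.u) (hv : y ≠ e.v) (z : Fin N) :
    (applyEvent G e).Adj y z ↔ G.Adj y z := by
  obtain ⟨u, v, _ | _⟩ := e
  · simp only [applyEvent, SimpleGraph.sup_adj, SimpleGraph.edge_adj]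
    simp only at hu hv
    grind
  · simp only [applyEvent, SimpleGraph.deleteEdges_adj, Set.mem_singleton_iff, Sym2.eq_iff]
    simp only at hu hv
    grind

theorem deg_applyEvent_of_ne {N : ℕ} (G : SimpleGraph (Fin N)) (e : EdgeEvent N) {y : Fin N}
    (hu : y ≠ e.u) (hv : y ≠ e.v) : deg (applyEvent G e) y = deg G y := by
  unfold deg
  congr 1
  ext z
  exact applyEvent_adj_of_ne G e hu hv z

/-- The correction at `u` keeps the quotient of estimate and degree, stated without division so
that it includes the degree `0`. -/
theorem ArcEvent.add_arcShift_mul_deg {N : ℕ} {op : EdgeOp} {G H : SimpleGraph (Fin N)}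
    {u v : Fin N} (h : ArcEvent op G H u v) {p : Fin N → ℝ} (hp : deg G u = 0 → p u = 0) :
    (p u + arcShift H op p u) * (deg G u : ℝ) = p u * (deg H u : ℝ) := by
  cases op with
  | insert =>
    have hd : deg H u = deg G u + 1 := by
      unfold deg
      rw [h.2, Set.ncard_insert_of_notMem h.1]
    simp only [arcShift, hd]
    push_cast
    rw [add_sub_cancel_right]
    by_cases h0 : deg G u = 0
    · simp [h0, hp h0]
    · have : (deg G u : ℝ) ≠ 0 := by exact_mod_cast h0
      field_simp
  | delete =>
    have hd : deg G u = deg H u + 1 := by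
      unfold deg
      rw [h.2, Set.ncard_insert_of_notMem h.1]
    simp only [arcShift, hd]
    push_cast
    have : (deg H u : ℝ) + 1 ≠ 0 := by positivity
    field_simp
    ring

theorem ArcEvent.add_arcShift_eq_zero {N : ℕ} {op : EdgeOp} {G H : SimpleGraph (Fin N)}
    {u v : Fin N} (h : ArcEvent op G H u v) {p : Fin N → ℝ} (h0 : deg H u = 0) :
    p u + arcShift H op p u = 0 := by
  cases op with
  | insert =>
    have hd : deg H u = deg G u + 1 := by
      unfold deg
      rw [h.2, Set.ncard_insert_of_notMem h.1]
    omega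
  | delete => simp [arcShift, h0]

open Classical in
/-- Since the correction keeps the quotient of estimate and degree, the only change in the flow out
of `u` is the one along the arc that is inserted or deleted. -/
theorem ArcEvent.flow {N : ℕ} {op : EdgeOp} {G H : SimpleGraph (Fin N)}
    {u v : Fin N} (h : ArcEvent op G H u v) {p : Fin N → ℝ} (hp : deg G u = 0 → p u = 0)
    (z : Fin N) :
    (if H.Adj u z then (p u + arcShift H op p u) / (deg H u : ℝ) else 0)
      = (if G.Adj u z then p u / (deg G u : ℝ) else 0)
        + if z = v then arcShift H op p u else 0 := by
  cases op with
  | insert =>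
    have hd : deg H u = deg G u + 1 := by
      unfold deg
      rw [h.2, Set.ncard_insert_of_notMem h.1]
    have ha : H.Adj u z ↔ z = v ∨ G.Adj u z := by
      rw [← SimpleGraph.mem_neighborSet, h.2]
      rfl
    have hv : ¬ G.Adj u v := h.1
    have hq : (p u + arcShift H EdgeOp.insert p u) / (deg H u : ℝ) = p u / (deg G u : ℝ) := by
      simp only [arcShift, hd]
      push_cast
      rw [add_sub_cancel_right]
      by_cases h0 : deg G u = 0
      · simp [h0, hp h0]
      · have : (deg G u : ℝ) ≠ 0 := by exact_mod_cast h0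
        field_simp
    have hs : arcShift H EdgeOp.insert p u = p u / (deg G u : ℝ) := by
      simp [arcShift, hd]
    rw [hq, hs]
    by_cases hz : z = v
    · subst hz
      simp [ha, hv]
    · simp [ha, hz]
  | delete =>
    have hd : deg G u = deg H u + 1 := by
      unfold deg
      rw [h.2, Set.ncard_insert_of_notMem h.1]
    have ha : G.Adj u z ↔ z = v ∨ H.Adj u z := by
      rw [← SimpleGraph.mem_neighborSet, h.2]
      rfl
    have hv : ¬ H.Adj u v := h.1
    have hs : arcShift H EdgeOp.delete p u = -(p u / (deg G u : ℝ)) := by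
      simp [arcShift, hd]
    by_cases hz : z = v
    · subst hz
      simp [ha, hv, hs]
    · by_cases hH : H.Adj u z
      · have h0 : (deg H u : ℝ) ≠ 0 := by
          have := mem_nodes.1 (mem_nodes_of_adj hH)
          positivity
        have h1 : (deg H u : ℝ) + 1 ≠ 0 := by positivity
        simp only [ha, hz, hH, hs, hd, or_true, if_true, if_false]
        push_cast
        field_simp
        ring
      · simp [ha, hz, hH]

/-- The state after both arcs of an event have been processed. -/
noncomputable def adjustEvent {N : ℕ} (G : SimpleGraph (Fin N)) (α : ℝ) (e : EdgeEvent N)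
    (x : PushState N) : PushState N :=
  adjustArc (applyEvent G e) α e.op e.v e.u (adjustArc (applyEvent G e) α e.op e.u e.v x)

theorem adjustArc_p {N : ℕ} (G : SimpleGraph (Fin N)) (α : ℝ) (op : EdgeOp) (u v : Fin N)
    (x : PushState N) (y : Fin N) :
    (adjustArc G α op u v x).p y = if y = u then x.p y + arcShift G op x.p u else x.p y := by
  cases op <;> rfl

theorem adjustArc_r {N : ℕ} (G : SimpleGraph (Fin N)) (α : ℝ) (op : EdgeOp) (u v : Fin N)
    (x : PushState N) (y : Fin N) :
    (adjustArc G α op u v x).r y =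
      if y = u then x.r y - arcShift G op x.p u / α
      else if y = v then x.r y + arcShift G op x.p u / α - arcShift G op x.p u else x.r y := by
  cases op <;> rfl

theorem arcShift_congr {N : ℕ} (G : SimpleGraph (Fin N)) (op : EdgeOp) {p p' : Fin N → ℝ}
    {u : Fin N} (h : p u = p' u) : arcShift G op p u = arcShift G op p' u := by
  cases op <;> simp [arcShift, h]

theorem adjustEvent_p {N : ℕ} {G : SimpleGraph (Fin N)} {α : ℝ} {e : EdgeEvent N}
    (he : e.u ≠ e.v) (x : PushState N) (y : Fin N) :
    (adjustEvent G α e x).p y =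
      if y = e.u ∨ y = e.v then x.p y + arcShift (applyEvent G e) e.op x.p y else x.p y := by
  have h := arcShift_congr (applyEvent G e) e.op (u := e.v)
    (p := (adjustArc (applyEvent G e) α e.op e.u e.v x).p) (p' := x.p)
    (by rw [adjustArc_p, if_neg he.symm])
  rw [adjustEvent, adjustArc_p, h, adjustArc_p]
  by_cases h1 : y = e.v
  · subst h1
    simp [he.symm]
  · by_cases h2 : y = e.u
    · subst h2
      simp [he]
    · simp [h1, h2]

theorem adjustEvent_r {N : ℕ} {G : SimpleGraph (Fin N)} {α : ℝ} (hα : 0 < α)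
    {e : EdgeEvent N} (he : e.u ≠ e.v) (x : PushState N) (y : Fin N) :
    α * (adjustEvent G α e x).r y =
      α * x.r y
      - (if y = e.u ∨ y = e.v then arcShift (applyEvent G e) e.op x.p y else 0)
      + (1 - α) * ((if y = e.v then arcShift (applyEvent G e) e.op x.p e.u else 0)
        + if y = e.u then arcShift (applyEvent G e) e.op x.p e.v else 0) := by
  have h := arcShift_congr (applyEvent G e) e.op (u := e.v)
    (p := (adjustArc (applyEvent G e) α e.op e.u e.v x).p) (p' := x.p)
    (by rw [adjustArc_p, if_neg he.symm])
  rw [adjustEvent, adjustArc_r, h, adjustArc_r]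
  by_cases h1 : y = e.v
  · subst h1
    simp only [he.symm, if_true, if_false, or_true]
    field_simp
    ring
  · by_cases h2 : y = e.u
    · subst h2
      simp only [he, if_true, if_false, true_or]
      field_simp
      ring
    · simp [h1, h2]

theorem PushInvariant.adjustEvent {N : ℕ} {G : SimpleGraph (Fin N)} {α : ℝ} {s : Fin N}
    {x : PushState N} (hα : 0 < α) (h : PushInvariant G α s x) {e : EdgeEvent N}
    (he : ValidEvent G e) :
    PushInvariant (applyEvent G e) α s (adjustEvent G α e x) := by
  classical
  have hne := he.ne
  refine ⟨fun y hy => ?_, fun z => ?_⟩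
  · rw [adjustEvent_p hne]
    by_cases h1 : y = e.u
    · subst h1
      simpa using he.arcEvent.add_arcShift_eq_zero hy
    · by_cases h2 : y = e.v
      · subst h2
        simpa using he.arcEvent_symm.add_arcShift_eq_zero hy
      · rw [deg_applyEvent_of_ne G e h1 h2] at hy
        simpa [h1, h2] using h.p_eq_zero y hy
  · have hin : inflow (applyEvent G e) (_root_.adjustEvent G α e x).p z
        = inflow G x.p z + ((if z = e.v then arcShift (applyEvent G e) e.op x.p e.u else 0)
          + if z = e.u then arcShift (applyEvent G e) e.op x.p e.v else 0) := by
      have hterm : ∀ y, (if (applyEvent G e).Adj y z then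
            (_root_.adjustEvent G α e x).p y / (deg (applyEvent G e) y : ℝ) else 0)
          = (if G.Adj y z then x.p y / (deg G y : ℝ) else 0)
            + ((if y = e.u then
                  if z = e.v then arcShift (applyEvent G e) e.op x.p e.u else 0 else 0)
              + if y = e.v then
                  if z = e.u then arcShift (applyEvent G e) e.op x.p e.v else 0 else 0) := by
        intro y
        rw [adjustEvent_p hne]
        by_cases h1 : y = e.u
        · subst h1
          rw [if_pos (Or.inl rfl), he.arcEvent.flow (h.p_eq_zero _)]
          simp [hne]
        · by_cases h2 : y = e.v
          · subst h2
            rw [if_pos (Or.inr rfl), he.arcEvent_symm.flow (h.p_eq_zero _)]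
            simp [hne.symm]
          · simp [h1, h2, applyEvent_adj_of_ne G e h1 h2, deg_applyEvent_of_ne G e h1 h2]
      unfold inflow
      rw [Finset.sum_congr rfl fun y _ => hterm y, Finset.sum_add_distrib,
        Finset.sum_add_distrib]
      simp
    rw [adjustEvent_r hα hne, hin, adjustEvent_p hne]
    have := h.residual z
    split_ifs <;> linarith

/-- An event does not increase the quotient of estimate and degree. -/
theorem abs_adjustEvent_p_le {N : ℕ} {G : SimpleGraph (Fin N)} {α : ℝ} {x : PushState N}
    (hp : ∀ u, deg G u = 0 → x.p u = 0) {e : EdgeEvent N} (he : ValidEvent G e)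
    {c : Fin N → ℝ} (hc0 : ∀ y, 0 ≤ c y) (hc : ∀ y, |x.p y| ≤ c y * (deg G y : ℝ)) (y : Fin N) :
    |(adjustEvent G α e x).p y| ≤ c y * (deg (applyEvent G e) y : ℝ) := by
  have key : ∀ v, ArcEvent e.op G (applyEvent G e) y v →
      |x.p y + arcShift (applyEvent G e) e.op x.p y| ≤ c y * (deg (applyEvent G e) y : ℝ) := by
    intro v ha
    by_cases h0 : deg G y = 0
    · have h1 : x.p y = 0 := hp y h0
      have h2 : x.p y + arcShift (applyEvent G e) e.op x.p y = 0 := by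
        cases e.op <;> simp [arcShift, h1]
      rw [h2, abs_zero]
      exact mul_nonneg (hc0 y) (Nat.cast_nonneg _)
    · have hd : 0 < (deg G y : ℝ) := by exact_mod_cast Nat.pos_of_ne_zero h0
      have h1 := congrArg abs (ha.add_arcShift_mul_deg (hp y))
      rw [abs_mul, abs_mul, Nat.abs_cast, Nat.abs_cast] at h1
      refine le_of_mul_le_mul_right ?_ hd
      rw [h1]
      calc |x.p y| * (deg (applyEvent G e) y : ℝ)
          ≤ (c y * (deg G y : ℝ)) * (deg (applyEvent G e) y : ℝ) :=
            mul_le_mul_of_nonneg_right (hc y) (Nat.cast_nonneg _)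
        _ = _ := by ring
  rw [adjustEvent_p he.ne]
  by_cases h1 : y = e.u
  · rw [if_pos (Or.inl h1)]
    exact key e.v (h1 ▸ he.arcEvent)
  · by_cases h2 : y = e.v
    · rw [if_pos (Or.inr h2)]
      exact key e.u (h2 ▸ he.arcEvent_symm)
    · rw [if_neg (by simp [h1, h2]), deg_applyEvent_of_ne G e h1 h2]
      exact hc y

theorem processBatch_cons {N : ℕ} (α : ℝ) (G : SimpleGraph (Fin N)) (e : EdgeEvent N)
    (es : List (EdgeEvent N)) (x : PushState N) :
    processBatch α G (e :: es) x = processBatch α (applyEvent G e) es (adjustEvent G α e x) :=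
  rfl

theorem PushInvariant.processBatch {N : ℕ} {α : ℝ} (hα : 0 < α) {s : Fin N}
    {B : List (EdgeEvent N)} {G H : SimpleGraph (Fin N)} {x : PushState N}
    (hB : IsBatch G B H) (h : PushInvariant G α s x) :
    PushInvariant H α s (processBatch α G B x) := by
  induction B generalizing G x with
  | nil => exact hB ▸ h
  | cons e es ih => exact ih hB.2 (h.adjustEvent hα hB.1)

theorem abs_processBatch_p_le {N : ℕ} {α : ℝ} (hα : 0 < α) {s : Fin N}
    {B : List (EdgeEvent N)} {G H : SimpleGraph (Fin N)} {x : PushState N}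
    (hB : IsBatch G B H) (h : PushInvariant G α s x)
    {c : Fin N → ℝ} (hc0 : ∀ y, 0 ≤ c y) (hc : ∀ y, |x.p y| ≤ c y * (deg G y : ℝ)) (y : Fin N) :
    |(processBatch α G B x).p y| ≤ c y * (deg H y : ℝ) := by
  induction B generalizing G x with
  | nil =>
    have hB : G = H := hB
    exact hB ▸ hc y
  | cons e es ih =>
    exact ih hB.2 (h.adjustEvent hα hB.1) (abs_adjustEvent_p_le h.p_eq_zero hB.1 hc0 hc)

theorem processBatch_initState {N : ℕ} (α : ℝ) (G : SimpleGraph (Fin N))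
    (B : List (EdgeEvent N)) (s : Fin N) :
    processBatch α G B (initState s) = initState s := by
  have hadj : ∀ (H : SimpleGraph (Fin N)) (op : EdgeOp) (u v : Fin N),
      adjustArc H α op u v (initState s) = initState s := by
    intro H op u v
    have h0 : arcShift H op (initState s).p u = 0 := by cases op <;> simp [arcShift, initState]
    ext y
    · rw [adjustArc_p, h0]
      simp
    · rw [adjustArc_r, h0]
      simp
  induction B generalizing G with
  | nil => rfl
  | cons e es ih => rw [processBatch_cons, adjustEvent, hadj, hadj, ih]

/-! ### The forward push -/

theorem l1_push_le {N : ℕ} (G : SimpleGraph (Fin N)) {α : ℝ} (hα1 : α ≤ 1) (x : PushState N)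
    {u : Fin N} (hu : u ∈ nodes G) :
    l1 (push G α x u).r + α * |x.r u| ≤ l1 x.r := by
  classical
  have hd : 0 < (deg G u : ℝ) := by exact_mod_cast mem_nodes.1 hu
  have h1 : ∀ y, |(push G α x u).r y| ≤ (|x.r y| - if y = u then |x.r u| else 0)
      + (1 - α) * |x.r u| / (deg G u : ℝ) * (if G.Adj u y then 1 else 0) := by
    intro y
    by_cases hy : y = u
    · subst hy
      simp [push]
    · by_cases ha : G.Adj u y
      · simp only [push, hy, ha, if_true, if_false, sub_zero, mul_one]
        refine (abs_add_le _ _).trans_eq ?_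
        rw [abs_div, abs_mul, Nat.abs_cast, abs_of_nonneg (sub_nonneg.2 hα1)]
      · simp [push, hy, ha]
  have h2 := Finset.sum_le_sum fun y (_ : y ∈ Finset.univ) => h1 y
  rw [Finset.sum_add_distrib, Finset.sum_sub_distrib, ← Finset.mul_sum, ← deg_eq_sum,
    div_mul_cancel₀ _ hd.ne', Finset.sum_ite_eq' Finset.univ u] at h2
  simp only [Finset.mem_univ, if_true] at h2
  unfold l1
  linarith

/-- The number of switches between the two loops that precede a phase. -/
def Phase.rank : Phase → ℝ
  | Phase.positive => 0
  | Phase.negative => 1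

/-- Each step pays for its cost with a decrease of the `ℓ¹`-norm of the residual, except for the
switch between the loops. -/
theorem PushStep.cost_le {N : ℕ} {G : SimpleGraph (Fin N)} {α η : ℝ} (hα : 0 < α)
    (hα1 : α ≤ 1) (hη : 0 ≤ η) {a b : Phase × PushState N} {k : ℕ} (h : PushStep G α η a k b) :
    α * η * (k + a.1.rank - b.1.rank) ≤ 2 * (l1 a.2.r - l1 b.2.r) := by
  have key : ∀ (x : PushState N) (u : Fin N), u ∈ nodes G → η * (deg G u : ℝ) < |x.r u| →
      α * η * ((deg G u : ℝ) + 1) ≤ 2 * (l1 x.r - l1 (push G α x u).r) := by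
    intro x u hu hr
    have h1 := l1_push_le G hα1 x hu
    have h2 : (1 : ℝ) ≤ deg G u := by exact_mod_cast mem_nodes.1 hu
    have h3 : α * (η * (deg G u : ℝ)) ≤ α * |x.r u| := mul_le_mul_of_nonneg_left hr.le hα.le
    -- Nodes have positive degree, so the cost `deg u + 1` is at most `2 deg u`.
    have h4 : α * η * ((deg G u : ℝ) + 1) ≤ α * η * (2 * (deg G u : ℝ)) :=
      mul_le_mul_of_nonneg_left (by linarith) (mul_nonneg hα.le hη)
    linarith
  cases h with
  | positive x u hu hr =>
    have := key x u hu (hr.trans_le (le_abs_self _))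
    simpa [Phase.rank] using this
  | switch x h => simp [Phase.rank]
  | negative x u hu hr =>
    have := key x u hu (by
      have := neg_le_abs (x.r u)
      linarith)
    simpa [Phase.rank] using this

theorem PushSteps.cost_le {N : ℕ} {G : SimpleGraph (Fin N)} {α η : ℝ} (hα : 0 < α)
    (hα1 : α ≤ 1) (hη : 0 ≤ η) {a b : Phase × PushState N} {k : ℕ} (h : PushSteps G α η a k b) :
    α * η * (k + a.1.rank - b.1.rank) ≤ 2 * (l1 a.2.r - l1 b.2.r) := by
  induction h with
  | refl => simp
  | tail _ h' ih =>
    have := h'.cost_le hα hα1 hη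
    push_cast
    linarith

theorem ForwardPush.cost_le {N : ℕ} {G : SimpleGraph (Fin N)} {α η : ℝ} (hα : 0 < α)
    (hα1 : α ≤ 1) (hη : 0 < η) {x y : PushState N} {k : ℕ} (h : ForwardPush G α η x k y) :
    (k : ℝ) ≤ 1 + 2 * l1 x.r / (α * η) := by
  have h1 := h.1.cost_le hα hα1 hη.le
  have h2 := l1_nonneg y.r
  simp only [Phase.rank] at h1
  have h3 : (k : ℝ) - 1 ≤ 2 * l1 x.r / (α * η) := by
    rw [le_div_iff₀ (mul_pos hα hη)]
    linarith
  linarith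

theorem pushTerminates_of_pos {N : ℕ} (G : SimpleGraph (Fin N)) {α η : ℝ} (hα : 0 < α)
    (hα1 : α ≤ 1) (hη : 0 < η) (x : PushState N) : PushTerminates G α η x := by
  rintro ⟨f, hf0, hf⟩
  have hcost : ∀ {a b : Phase × PushState N} {k : ℕ}, PushStep G α η a k b → (1 : ℝ) ≤ k := by
    intro a b k h
    cases h <;> simp
  have hstep : ∀ i, 2 * l1 (f (i + 1)).2.r - α * η * (f (i + 1)).1.rank + α * η
      ≤ 2 * l1 (f i).2.r - α * η * (f i).1.rank := by
    intro i
    obtain ⟨k, hk⟩ := hf i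
    have h1 := hk.cost_le hα hα1 hη.le
    have h2 : α * η * 1 ≤ α * η * k := mul_le_mul_of_nonneg_left (hcost hk) (mul_pos hα hη).le
    linarith
  have hall : ∀ i : ℕ, 2 * l1 (f i).2.r - α * η * (f i).1.rank + i * (α * η)
      ≤ 2 * l1 x.r := by
    intro i
    induction i with
    | zero => simp [hf0, Phase.rank]
    | succ i ih =>
      have := hstep i
      push_cast
      linarith
  obtain ⟨n, hn⟩ := exists_nat_gt ((2 * l1 x.r + α * η) / (α * η))
  rw [div_lt_iff₀ (mul_pos hα hη)] at hn
  have h1 := hall n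
  have h2 := l1_nonneg (f n).2.r
  have h3 : α * η * (f n).1.rank ≤ α * η := by
    have : (f n).1.rank ≤ 1 := by cases (f n).1 <;> simp [Phase.rank]
    exact mul_le_of_le_one_right (mul_pos hα hη).le this
  linarith

theorem pushTerminates_of_nodes_eq_empty {N : ℕ} {G : SimpleGraph (Fin N)} (α η : ℝ)
    (hG : nodes G = ∅) (x : PushState N) : PushTerminates G α η x := by
  rintro ⟨f, _, hf⟩
  have hneg : ∀ a b k, PushStep G α η a k b → a.1 = Phase.positive ∧ b.1 = Phase.negative := by
    intro a b k h
    cases h with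
    | positive x u hu hr => simp [hG] at hu
    | switch x h => exact ⟨rfl, rfl⟩
    | negative x u hu hr => simp [hG] at hu
  obtain ⟨k, h0⟩ := hf 0
  obtain ⟨l, h1⟩ := hf 1
  have := (hneg _ _ _ h0).2.symm.trans (hneg _ _ _ h1).1
  cases this

/-- A property of states that every admissible push preserves holds after a forward push. -/
theorem ForwardPush.induction {N : ℕ} {G : SimpleGraph (Fin N)} {α η : ℝ}
    {P : PushState N → Prop} {x y : PushState N} {k : ℕ} (h : ForwardPush G α η x k y)
    (hpos : ∀ z u, u ∈ nodes G → η * (deg G u : ℝ) < z.r u → P z → P (push G α z u))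
    (hneg : ∀ z u, u ∈ nodes G → z.r u < -(η * (deg G u : ℝ)) → P z → P (push G α z u))
    (hx : P x) : P y := by
  have : ∀ {a b : Phase × PushState N} {k : ℕ}, PushSteps G α η a k b → P a.2 → P b.2 := by
    intro a b k h ha
    induction h with
    | refl => exact ha
    | tail _ h' ih =>
      cases h' with
      | positive x u hu hr => exact hpos x u hu hr ih
      | switch x h => exact ih
      | negative x u hu hr => exact hneg x u hu hr ih
  exact this h.1 hx

theorem PushInvariant.forwardPush {N : ℕ} {G : SimpleGraph (Fin N)} {α η : ℝ} {s : Fin N}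
    {x y : PushState N} {k : ℕ} (hx : PushInvariant G α s x) (h : ForwardPush G α η x k y) :
    PushInvariant G α s y :=
  h.induction (fun _ _ hu _ hz => hz.push hu) (fun _ _ hu _ hz => hz.push hu) hx

/-- At the end of a forward push both loops are exhausted: a push in the second loop only lowers
residuals of other nodes, so it cannot make a node eligible for the first loop again. -/
theorem ForwardPush.abs_residual_le {N : ℕ} {G : SimpleGraph (Fin N)} {α η : ℝ} (hα1 : α ≤ 1)
    (hη : 0 ≤ η) {x y : PushState N} {k : ℕ} (h : ForwardPush G α η x k y) {u : Fin N}
    (hu : u ∈ nodes G) : |y.r u| ≤ η * (deg G u : ℝ) := by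
  have upper : ∀ {a b : Phase × PushState N} {k : ℕ}, PushSteps G α η a k b →
      a.1 = Phase.positive → b.1 = Phase.negative →
      ∀ u ∈ nodes G, b.2.r u ≤ η * (deg G u : ℝ) := by
    intro a b k h
    induction h with
    | refl =>
      intro h1 h2
      rw [h1] at h2
      cases h2
    | tail _ h' ih =>
      intro ha hb
      cases h' with
      | positive x u hu hr => cases hb
      | switch x h => exact h
      | negative x w hw hr =>
        intro u hu
        have h1 := ih ha rfl u hu
        have hneg : x.r w ≤ 0 := by
          have : 0 ≤ η * (deg G w : ℝ) := mul_nonneg hη (Nat.cast_nonneg _)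
          linarith
        simp only [push]
        split_ifs
        · exact mul_nonneg hη (Nat.cast_nonneg _)
        · have : (1 - α) * x.r w / (deg G w : ℝ) ≤ 0 :=
            div_nonpos_of_nonpos_of_nonneg
              (mul_nonpos_of_nonneg_of_nonpos (sub_nonneg.2 hα1) hneg) (Nat.cast_nonneg _)
          simp only at h1
          linarith
        · exact h1
  exact abs_le.2 ⟨h.2 u hu, upper h.1 rfl rfl u hu⟩

theorem ForwardPush.nonneg {N : ℕ} {G : SimpleGraph (Fin N)} {α η : ℝ} (hα : 0 < α)
    (hα1 : α ≤ 1) (hη : 0 ≤ η) {x y : PushState N} {k : ℕ} (h : ForwardPush G α η x k y)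
    (hx : ∀ u, 0 ≤ x.p u ∧ 0 ≤ x.r u) : ∀ u, 0 ≤ y.p u ∧ 0 ≤ y.r u := by
  refine h.induction (P := fun z => ∀ u, 0 ≤ z.p u ∧ 0 ≤ z.r u) ?_ ?_ hx
  · intro z u _ _ hz v
    have h1 : 0 ≤ α * z.r u := mul_nonneg hα.le (hz u).2
    have h2 : 0 ≤ (1 - α) * z.r u / (deg G u : ℝ) :=
      div_nonneg (mul_nonneg (sub_nonneg.2 hα1) (hz u).2) (Nat.cast_nonneg _)
    have h3 := hz v
    constructor
    · simp only [push]
      split_ifs <;> linarith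
    · simp only [push]
      split_ifs <;> linarith
  · intro z u _ hr hz
    have h1 := (hz u).2
    have h2 : 0 ≤ η * (deg G u : ℝ) := mul_nonneg hη (Nat.cast_nonneg _)
    linarith

/-- Nothing is pushed for a source outside the graph. -/
theorem ForwardPush.eq_initState {N : ℕ} {G : SimpleGraph (Fin N)} {α η : ℝ} (hη : 0 ≤ η)
    {s : Fin N} (hs : s ∉ nodes G) {y : PushState N} {k : ℕ}
    (h : ForwardPush G α η (initState s) k y) : y = initState s := by
  have hr0 : ∀ u ∈ nodes G, (initState s).r u = 0 := by
    intro u hu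
    have : u ≠ s := by
      rintro rfl
      exact hs hu
    simp [initState, this]
  refine h.induction (P := fun z => z = initState s) ?_ ?_ rfl
  · rintro z u hu hr rfl
    rw [hr0 u hu] at hr
    have h2 : 0 ≤ η * (deg G u : ℝ) := mul_nonneg hη (Nat.cast_nonneg _)
    linarith
  · rintro z u hu hr rfl
    rw [hr0 u hu] at hr
    have h2 : 0 ≤ η * (deg G u : ℝ) := mul_nonneg hη (Nat.cast_nonneg _)
    linarith

/-! ### Estimates summed over the sources -/

theorem PushInvariant.abs_p_le {N : ℕ} {G : SimpleGraph (Fin N)} {α : ℝ} {s : Fin N}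
    {x : PushState N} (hα : 0 < α) (hα1 : α ≤ 1) (h : PushInvariant G α s x) {v : Fin N} {b : ℝ}
    (hr : |x.r v| ≤ b) :
    |x.p v| ≤ α * ((initState s).r v + b) + (1 - α) * inflow G (fun u => |x.p u|) v := by
  have h0 : 0 ≤ (initState s).r v := by
    simp only [initState]
    split_ifs <;> norm_num
  have h1 := mul_le_mul_of_nonneg_left (abs_inflow_le G x.p v) (sub_nonneg.2 hα1)
  have h2 : |(1 - α) * inflow G x.p v| = (1 - α) * |inflow G x.p v| := by
    rw [abs_mul, abs_of_nonneg (sub_nonneg.2 hα1)]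
  have h3 := abs_le.1 h2.le
  have h4 : |α * x.r v| ≤ α * b := by
    rw [abs_mul, abs_of_pos hα]
    exact mul_le_mul_of_nonneg_left hr hα.le
  have h5 := abs_le.1 h4
  have h6 := h.residual v
  have h7 := mul_nonneg hα.le h0
  rw [abs_le]
  constructor <;> linarith [h3.1, h3.2, h5.1, h5.2]

/-- If every estimate satisfies the personalized PageRank inequality up to an error `b s v`, then
the maximum principle bounds the sum of the estimates over the sources. -/
theorem sum_abs_p_le_of_le {N : ℕ} {G : SimpleGraph (Fin N)} {α K : ℝ} (hα : 0 < α)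
    (hα1 : α ≤ 1) {x : Fin N → PushState N} (h0 : ∀ s u, deg G u = 0 → (x s).p u = 0)
    {b : Fin N → ℝ} (hb : ∀ v ∈ nodes G, (1 : ℝ) + (nodes G).card * b v ≤ K * (deg G v : ℝ))
    (h : ∀ s, ∀ v ∈ nodes G, |(x s).p v| ≤
      α * ((initState s).r v + b v) + (1 - α) * inflow G (fun u => |(x s).p u|) v)
    (v : Fin N) : ∑ s ∈ nodes G, |(x s).p v| ≤ K * (deg G v : ℝ) := by
  by_cases hv : v ∈ nodes G
  · refine le_mul_deg_of_le_inflow G hα hα1 (fun u => ∑ s ∈ nodes G, |(x s).p u|) ?_ v hv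
    intro v hv
    refine (Finset.sum_le_sum fun s _ => h s v hv).trans ?_
    rw [Finset.sum_add_distrib, ← Finset.mul_sum, ← Finset.mul_sum, Finset.sum_add_distrib,
      inflow_sum]
    have h1 : ∑ s ∈ nodes G, (initState s).r v = 1 := by
      simp [initState, hv]
    rw [h1, Finset.sum_const, nsmul_eq_mul]
    have := mul_le_mul_of_nonneg_left (hb v hv) hα.le
    linarith
  · have hd := deg_eq_zero_of_notMem_nodes hv
    simp [hd, fun s => h0 s v hd]

section Run

variable {N d : ℕ} {hd : ℕ → Fin d} {hsgn : ℕ → ℤˣ} {T : ℕ} {G : ℕ → SimpleGraph (Fin N)}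
  {B : ℕ → List (EdgeEvent N)} {m : ℕ → ℕ} {α ε ε₀ : ℝ}

theorem IsRun.pushInvariant {s : Fin N} {x : ℕ → PushState N} {w : ℕ → Fin d → ℝ} {c : ℕ → ℕ}
    (h : IsRun hd hsgn T G B m α ε ε₀ s x w c) (hα : 0 < α)
    (hB : ∀ t < T, IsBatch (G t) (B t) (G (t + 1))) {t : ℕ} (ht : t ≤ T) :
    PushInvariant (G t) α s (x t) := by
  induction t with
  | zero =>
    obtain ⟨k, hk, -⟩ := h.init
    exact (pushInvariant_initState (G 0) α s).forwardPush hk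
  | succ t ih =>
    obtain ⟨k, hk, -⟩ := h.step t ht
    exact ((ih (Nat.le_of_succ_le ht)).processBatch hα (hB t ht)).forwardPush hk

/-- The state of a source that has not yet appeared is still the initial one. -/
theorem IsRun.eq_initState {s : Fin N} {x : ℕ → PushState N} {w : ℕ → Fin d → ℝ} {c : ℕ → ℕ}
    (h : IsRun hd hsgn T G B m α ε ε₀ s x w c) (hε : 0 < ε) (hε₀ : 0 < ε₀) {t : ℕ}
    (ht : t ≤ T) (hs : ∀ j ≤ t, s ∉ nodes (G j)) : x t = initState s := by
  induction t with
  | zero =>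
    obtain ⟨k, hk, -⟩ := h.init
    exact ForwardPush.eq_initState hε₀.le (hs 0 le_rfl) hk
  | succ t ih =>
    obtain ⟨k, hk, -⟩ := h.step t ht
    rw [ih (Nat.le_of_succ_le ht) fun j hj => hs j (Nat.le_succ_of_le hj),
      processBatch_initState] at hk
    exact ForwardPush.eq_initState (by positivity) (hs (t + 1) le_rfl) hk

/-- After every call, the estimates at `v`, summed over the sources in the graph, are at most a
constant multiple of the degree of `v`. -/
theorem sum_abs_p_le {x : Fin N → ℕ → PushState N} {w : Fin N → ℕ → Fin d → ℝ}
    {c : Fin N → ℕ → ℕ} (h : ∀ s, IsRun hd hsgn T G B m α ε ε₀ s (x s) (w s) (c s))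
    (hα : 0 < α) (hα1 : α ≤ 1) (hε : 0 < ε) (hε2 : ε ≤ 2) (hε₀ : 0 < ε₀)
    (hB : ∀ t < T, IsBatch (G t) (B t) (G (t + 1)))
    (hm : ∀ t < T, (G (t + 1)).edgeSet.ncard ≤ m (t + 1)) {t : ℕ} (ht : t ≤ T) (v : Fin N) :
    ∑ s ∈ nodes (G t), |(x s t).p v| ≤ 5 * (deg (G t) v : ℝ) := by
  have hinv := fun s => (h s).pushInvariant hα hB ht
  cases t with
  | zero =>
    -- The precision of the initial call is arbitrary, but all its states are nonnegative, so the
    -- residual only helps in the estimate.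
    refine sum_abs_p_le_of_le hα hα1 (fun s => (hinv s).p_eq_zero) (b := fun _ => 0) ?_ ?_ v
    · intro v hv
      have : (1 : ℝ) ≤ deg (G 0) v := by exact_mod_cast mem_nodes.1 hv
      simp only [mul_zero, add_zero]
      linarith
    · intro s v _
      obtain ⟨k, hk, -⟩ := (h s).init
      have h0 : ∀ u, 0 ≤ (initState s).p u ∧ 0 ≤ (initState s).r u := by
        intro u
        simp only [initState]
        split_ifs <;> norm_num
      have hnn := hk.nonneg hα hα1 hε₀.le h0
      have habs : (fun u => |(x s 0).p u|) = (x s 0).p := by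
        funext u
        exact abs_of_nonneg (hnn u).1
      have h1 := (hinv s).residual v
      have h2 := mul_nonneg hα.le (hnn v).2
      rw [habs, abs_of_nonneg (hnn v).1]
      linarith
  | succ t =>
    refine sum_abs_p_le_of_le hα hα1 (fun s => (hinv s).p_eq_zero)
      (b := fun v => ε / (m (t + 1) : ℝ) * (deg (G (t + 1)) v : ℝ)) ?_ ?_ v
    · intro v hv
      have h1 : (1 : ℝ) ≤ deg (G (t + 1)) v := by exact_mod_cast mem_nodes.1 hv
      have h2 : ((nodes (G (t + 1))).card : ℝ) ≤ 2 * (m (t + 1) : ℝ) := by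
        exact_mod_cast (card_nodes_le _).trans (Nat.mul_le_mul_left 2 (hm t ht))
      have h3 : ((nodes (G (t + 1))).card : ℝ) * (ε / (m (t + 1) : ℝ)) ≤ 4 := by
        rw [← mul_div_assoc]
        refine div_le_of_le_mul₀ (Nat.cast_nonneg _) (by norm_num) ?_
        have := mul_le_mul h2 hε2 hε.le (by positivity)
        linarith
      have h4 := mul_le_mul_of_nonneg_right h3 (zero_le_one.trans h1)
      linarith
    · intro s v hv
      obtain ⟨k, hk, -⟩ := (h s).step t ht
      exact (hinv s).abs_p_le hα hα1 (hk.abs_residual_le hα1 (by positivity) hv)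

/-- After the batch has been processed, the estimates, summed over the labels and over the sources
in the new graph, are bounded by the volume of the new graph.  Sources that are new contribute
nothing, since their labels have not been used before. -/
theorem sum_l1_processBatch_le {x : Fin N → ℕ → PushState N} {w : Fin N → ℕ → Fin d → ℝ}
    {c : Fin N → ℕ → ℕ} (h : ∀ s, IsRun hd hsgn T G B m α ε ε₀ s (x s) (w s) (c s))
    (hα : 0 < α) (hα1 : α ≤ 1) (hε : 0 < ε) (hε2 : ε ≤ 2) (hε₀ : 0 < ε₀)
    (hB : ∀ t < T, IsBatch (G t) (B t) (G (t + 1)))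
    (hm : ∀ t < T, (G (t + 1)).edgeSet.ncard ≤ m (t + 1))
    (hlabel : ∀ i j k : ℕ, i ≤ j → j ≤ k → k ≤ T → nodes (G i) ∩ nodes (G k) ⊆ nodes (G j))
    {t : ℕ} (ht : t < T) :
    ∑ s ∈ nodes (G (t + 1)), l1 (processBatch α (G t) (B t) (x s t)).p
      ≤ 5 * ∑ v, (deg (G (t + 1)) v : ℝ) := by
  classical
  have hinv := fun s => (h s).pushInvariant hα hB ht.le
  have hnew : ∀ s ∈ nodes (G (t + 1)), s ∉ nodes (G t) → ∀ v, (x s t).p v = 0 := by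
    intro s hs hs' v
    have hbefore : ∀ j ≤ t, s ∉ nodes (G j) := fun j hj hsj =>
      hs' (hlabel j t (t + 1) hj (Nat.le_succ t) ht (Finset.mem_inter.2 ⟨hsj, hs⟩))
    rw [(h s).eq_initState hε hε₀ ht.le hbefore]
    rfl
  have hsum : ∀ v, ∑ s ∈ nodes (G (t + 1)), |(x s t).p v| / (deg (G t) v : ℝ) ≤ 5 := by
    intro v
    rw [← Finset.sum_div]
    refine div_le_of_le_mul₀ (Nat.cast_nonneg _) (by norm_num) ?_
    refine le_trans ?_ (sum_abs_p_le h hα hα1 hε hε2 hε₀ hB hm ht.le v)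
    calc ∑ s ∈ nodes (G (t + 1)), |(x s t).p v|
        = ∑ s ∈ nodes (G (t + 1)) ∩ nodes (G t), |(x s t).p v| := by
          refine (Finset.sum_subset Finset.inter_subset_left fun s hs hs' => ?_).symm
          rw [hnew s hs fun h' => hs' (Finset.mem_inter.2 ⟨hs, h'⟩), abs_zero]
      _ ≤ _ := Finset.sum_le_sum_of_subset_of_nonneg Finset.inter_subset_right
          fun _ _ _ => abs_nonneg _
  have hp : ∀ s v, |(processBatch α (G t) (B t) (x s t)).p v|
      ≤ |(x s t).p v| / (deg (G t) v : ℝ) * (deg (G (t + 1)) v : ℝ) := by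
    intro s
    refine abs_processBatch_p_le hα (hB t ht) (hinv s)
      (c := fun v => |(x s t).p v| / (deg (G t) v : ℝ)) (fun v => by positivity) fun v => ?_
    by_cases h0 : deg (G t) v = 0
    · simp [h0, (hinv s).p_eq_zero v h0]
    · have : (deg (G t) v : ℝ) ≠ 0 := by exact_mod_cast h0
      rw [div_mul_cancel₀ _ this]
  unfold l1
  rw [Finset.sum_comm, Finset.mul_sum]
  refine Finset.sum_le_sum fun v _ => ?_
  refine (Finset.sum_le_sum fun s _ => hp s v).trans ?_
  rw [← Finset.sum_mul]
  exact mul_le_mul_of_nonneg_right (hsum v) (Nat.cast_nonneg _)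

end Run

/-- The cost of one call, in terms of the estimate after the batch has been processed. -/
theorem DynamicSNE.cost_le {N d : ℕ} {hd : ℕ → Fin d} {hsgn : ℕ → ℤˣ} {G H : SimpleGraph (Fin N)}
    {B : List (EdgeEvent N)} {α η : ℝ} {s : Fin N} {x y : PushState N} {w : Fin d → ℝ} {c : ℕ}
    (h : DynamicSNE hd hsgn G H B α η x y w c) (hα : 0 < α) (hα1 : α ≤ 1) (hη : 0 < η)
    (hB : IsBatch G B H) (hx : PushInvariant G α s x) :
    (c : ℝ) ≤ 2 * B.length + (nodes H).card + 2
      + 2 / (α * η) * (1 + 2 / α * l1 (processBatch α G B x).p) := by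
  obtain ⟨k, hk, -, rfl⟩ := h
  have h1 := hk.cost_le hα hα1 hη
  have h2 := (hx.processBatch hα hB).l1_residual_le hα hα1
  have h3 : ((supportNodes H y.p).card : ℝ) ≤ (nodes H).card := by
    exact_mod_cast Finset.card_le_card (Finset.filter_subset _ _)
  have h4 : 2 / (α * η) * l1 (processBatch α G B x).r
      ≤ 2 / (α * η) * (1 + 2 * l1 (processBatch α G B x).p / α) :=
    mul_le_mul_of_nonneg_left h2 (by positivity)
  rw [mul_div_right_comm] at h1
  rw [mul_div_right_comm] at h4
  push_cast
  linarith

/-! ### The average running time -/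

theorem mainTheorem1 :
    ∃ C : ℝ, 0 < C ∧
      ∀ (N d T : ℕ) (hd : ℕ → Fin d) (hsgn : ℕ → ℤˣ)
        (α ε ε₀ : ℝ) (_ : 0 < α) (_ : α ≤ 1) (_ : 0 < ε) (_ : ε ≤ 2) (_ : 0 < ε₀)
        -- the snapshots, the update batches, and the numbers `m t`
        (G : ℕ → SimpleGraph (Fin N)) (B : ℕ → List (EdgeEvent N)) (m : ℕ → ℕ)
        (_ : ∀ t < T, IsBatch (G t) (B t) (G (t + 1)))
        (_ : ∀ t < T, (B t).length ≤ m (t + 1))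
        (_ : ∀ t < T, (G (t + 1)).edgeSet.ncard ≤ m (t + 1))
        -- the label of a node that has left the graph is not used again
        (_ : ∀ i j k : ℕ, i ≤ j → j ≤ k → k ≤ T → nodes (G i) ∩ nodes (G k) ⊆ nodes (G j))
        -- one run for each source
        (x : Fin N → ℕ → PushState N) (w : Fin N → ℕ → Fin d → ℝ) (c : Fin N → ℕ → ℕ)
        (_ : ∀ s, IsRun hd hsgn T G B m α ε ε₀ s (x s) (w s) (c s)),
        ∀ t < T,
          (∀ s, PushTerminates (G (t + 1)) α (ε / (m (t + 1) : ℝ))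
            (processBatch α (G t) (B t) (x s t))) ∧
          (∑ s ∈ nodes (G (t + 1)), (c s (t + 1) : ℝ)) / ((nodes (G (t + 1))).card : ℝ) ≤
            C * ((m (t + 1) : ℝ) / α ^ 2
              + (m (t + 1) : ℝ) * avgDegree (G (t + 1)) / (ε * α ^ 2)
              + (m (t + 1) : ℝ) / (ε * α)) := by
  refine ⟨20, by norm_num, ?_⟩
  intro N d T hd hsgn α ε ε₀ hα hα1 hε hε2 hε₀ G B m hB hlen hm hlabel x w c hrun t ht
  have hcard : ((nodes (G (t + 1))).card : ℝ) ≤ 2 * (m (t + 1) : ℝ) := by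
    exact_mod_cast (card_nodes_le _).trans (Nat.mul_le_mul_left 2 (hm t ht))
  rcases Finset.eq_empty_or_nonempty (nodes (G (t + 1))) with hempty | hne
  · refine ⟨fun s => pushTerminates_of_nodes_eq_empty _ _ hempty _, ?_⟩
    -- Both the average cost and the average degree are `0 / 0` here.
    simp only [avgDegree, hempty, Finset.sum_empty, zero_div, mul_zero, add_zero]
    positivity
  · have hn : (1 : ℝ) ≤ (nodes (G (t + 1))).card := by exact_mod_cast hne.card_pos
    have hn0 : (0 : ℝ) < (nodes (G (t + 1))).card := by linarith
    have hm1 : (1 : ℝ) ≤ m (t + 1) := by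
      have : (0 : ℝ) < m (t + 1) := by linarith
      exact_mod_cast this
    have hlen' : ((B t).length : ℝ) ≤ m (t + 1) := by exact_mod_cast hlen t ht
    have hη : 0 < ε / (m (t + 1) : ℝ) := by positivity
    refine ⟨fun s => pushTerminates_of_pos _ hα hα1 hη _, ?_⟩
    have hvol : ∑ v, (deg (G (t + 1)) v : ℝ)
        = (nodes (G (t + 1))).card * avgDegree (G (t + 1)) := by
      rw [avgDegree, mul_div_cancel₀ _ hn0.ne', sum_nodes_deg]
    have hp := sum_l1_processBatch_le hrun hα hα1 hε hε2 hε₀ hB hm hlabel ht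
    rw [hvol] at hp
    have hc := Finset.sum_le_sum fun s (_ : s ∈ nodes (G (t + 1))) =>
      ((hrun s).step t ht).cost_le hα hα1 hη (hB t ht) ((hrun s).pushInvariant hα hB ht.le)
    rw [Finset.sum_add_distrib, Finset.sum_const, ← Finset.mul_sum, Finset.sum_add_distrib,
      Finset.sum_const, ← Finset.mul_sum, nsmul_eq_mul, nsmul_eq_mul] at hc
    rw [div_le_iff₀ hn0]
    generalize hM : (m (t + 1) : ℝ) = M at *
    generalize hD : avgDegree (G (t + 1)) = D at *
    generalize hK : ((nodes (G (t + 1))).card : ℝ) = n at *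
    have hfac : 0 ≤ 2 / (α * (ε / M)) := by positivity
    have h1 := mul_le_mul_of_nonneg_left hp (by positivity : 0 ≤ 2 / α)
    have h2 := mul_le_mul_of_nonneg_left (add_le_add_right h1 (n * 1)) hfac
    have h3 : 2 / (α * (ε / M)) * (n * 1 + 2 / α * (5 * (n * D)))
        = n * (2 * (M / (ε * α)) + 20 * (M * D / (ε * α ^ 2))) := by
      field_simp
      ring
    have h4 : M ≤ M / α ^ 2 := by
      rw [le_div_iff₀ (by positivity)]
      exact mul_le_of_le_one_right (by linarith) (pow_le_one₀ hα.le hα1)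
    have h5 : n * (2 * ((B t).length : ℝ) + n + 2) ≤ n * (20 * (M / α ^ 2)) :=
      mul_le_mul_of_nonneg_left (by linarith) hn0.le
    have h6 : 0 ≤ n * (M / (ε * α)) := by positivity
    linarith
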